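/- **Proposition 4.6.** By an analytic family of compact complex manifolds over the disc $\mathbb{D}_\varepsilon=\{t\in\mathbb{C} : |t|<\varepsilon\}$, $\varepsilon>0$, we mean a complex manifold $\mathcal{X}$ together with a proper holomorphic submersion $\pi\colon\mathcal{X}\to\mathbb{D}_\varepsilon$; for $t\in\mathbb{D}_\varepsilon$ the member $M_t$ of the family is the compact complex submanifold $\pi^{-1}(t)$ of $\mathcal{X}$, and $J_t$ is its complex structure. A locally conformally symplectic (LCS) form taming the complex structure $J$ of a complex manifold $M$ is a smooth real $2$-form $\Omega$ on $M$ such that $d\Omega=\theta\wedge\Omega$ for some smooth closed real $1$-form $\theta$, and $\Omega(v,Jv)>0$ for every nonzero real tangent vector $v$ of $M$. Let $(M_t,J_t)_{t\in\mathbb{D}_\varepsilon}$ be an analytic family of compact complex manifolds such that $(M_0,J_0)$ admits an LCS form taming $J_0$. Then there is $\delta>0$ such that for every $t\in\mathbb{D}_\varepsilon$ with $|t|<\delta$ the manifold $(M_t,J_t)$ admits an LCS form taming $J_t$. -/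

import Mathlib

open scoped Manifold ContDiff Topology

noncomputable section

namespace LCSTaming

/-- Wedge product `θ ∧ Ω` of a `1`-form and a `2`-form, normalized as the exterior derivative
`extDeriv` is:
`(θ ∧ Ω)(v₀, v₁, v₂) = θ(v₀) Ω(v₁, v₂) - θ(v₁) Ω(v₀, v₂) + θ(v₂) Ω(v₀, v₁)`
(see `wedgeOneTwo_apply`). -/
def wedgeOneTwo {E : Type*} [NormedAddCommGroup E] [NormedSpace ℝ E]
    (θ : E [⋀^Fin 1]→L[ℝ] ℝ) (Ω : E [⋀^Fin 2]→L[ℝ] ℝ) : E [⋀^Fin 3]→L[ℝ] ℝ :=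
  ContinuousAlternatingMap.alternatizeUncurryFin
    (((ContinuousAlternatingMap.ofSubsingleton ℝ E ℝ (0 : Fin 1)).symm θ).smulRight Ω)

theorem wedgeOneTwo_apply {E : Type*} [NormedAddCommGroup E] [NormedSpace ℝ E]
    (θ : E [⋀^Fin 1]→L[ℝ] ℝ) (Ω : E [⋀^Fin 2]→L[ℝ] ℝ) (v₀ v₁ v₂ : E) :
    wedgeOneTwo θ Ω ![v₀, v₁, v₂] =
      θ ![v₀] * Ω ![v₁, v₂] - θ ![v₁] * Ω ![v₀, v₂] + θ ![v₂] * Ω ![v₀, v₁] := by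
  have h1 : Fin.removeNth 1 ![v₀, v₁, v₂] = ![v₀, v₂] := by
    ext i; fin_cases i <;> rfl
  have h2 : Fin.removeNth 2 ![v₀, v₁, v₂] = ![v₀, v₁] := by
    ext i; fin_cases i <;> rfl
  have h3 : ∀ v : E, (fun _ : Fin 1 ↦ v) = ![v] := by
    intro v; ext i; fin_cases i; rfl
  simp [wedgeOneTwo, ContinuousAlternatingMap.alternatizeUncurryFin_apply, Fin.sum_univ_three,
    h1, h2, h3, sub_eq_add_neg]

/-! In the rest of this section `M` is a complex manifold modelled on a complex normed space `E`;
its underlying real manifold is modelled on the real normed space underlying `E`, with the same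
charts. -/

section Forms

variable {E : Type*} [NormedAddCommGroup E] [NormedSpace ℂ E]
  {M : Type*} [TopologicalSpace M] [ChartedSpace E M]

variable (E M) in
/-- A (not necessarily smooth) real differential `k`-form on `M`. -/
abbrev RealForm (k : ℕ) : Type _ :=
  ∀ x : M, TangentSpace 𝓘(ℝ, E) x [⋀^Fin k]→L[ℝ] ℝ

/-- The coordinate expression `(e⁻¹)^* α` of the form `α` in the chart `e`
(meaningful on `e.target`). -/
def chartRep {k : ℕ} (e : OpenPartialHomeomorph M E) (α : RealForm E M k) :
    E → E [⋀^Fin k]→L[ℝ] ℝ :=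
  fun y ↦ (α (e.symm y)).compContinuousLinearMap (mfderiv 𝓘(ℝ, E) 𝓘(ℝ, E) e.symm y)

/-- `α` is smooth: its expression in every chart of the atlas is `C^∞`. -/
def IsSmoothForm {k : ℕ} (α : RealForm E M k) : Prop :=
  ∀ e ∈ atlas E M, ContDiffOn ℝ ∞ (chartRep e α) e.target

/-- `dα = 0`. -/
def IsClosedForm {k : ℕ} (α : RealForm E M k) : Prop :=
  ∀ e ∈ atlas E M, ∀ y ∈ e.target, extDeriv (chartRep e α) y = 0

/-- `dΩ = θ ∧ Ω`. -/
def IsLeeForm (θ : RealForm E M 1) (Ω : RealForm E M 2) : Prop :=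
  ∀ e ∈ atlas E M, ∀ y ∈ e.target,
    extDeriv (chartRep e Ω) y = wedgeOneTwo (chartRep e θ y) (chartRep e Ω y)

variable (E) in
/-- The complex structure `J` of `M`: multiplication by `i` on the tangent space at `x`, which is
identified with `E` by the preferred chart at `x`. -/
def complexStructure (x : M) : TangentSpace 𝓘(ℝ, E) x →L[ℝ] TangentSpace 𝓘(ℝ, E) x :=
  (Complex.I • ContinuousLinearMap.id ℝ E : E →L[ℝ] E)

/-- `Ω` tames the complex structure: `Ω(v, Jv) > 0` for all nonzero real tangent vectors `v`. -/
def Tames (Ω : RealForm E M 2) : Prop :=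
  ∀ (x : M) (v : TangentSpace 𝓘(ℝ, E) x), v ≠ 0 → 0 < Ω x ![v, complexStructure E x v]

variable (E M) in
/-- The complex manifold `M` admits a locally conformally symplectic form taming its complex
structure. -/
def AdmitsTamingLCSForm : Prop :=
  ∃ (Ω : RealForm E M 2) (θ : RealForm E M 1),
    IsSmoothForm Ω ∧ IsSmoothForm θ ∧ IsClosedForm θ ∧ IsLeeForm θ Ω ∧ Tames Ω

end Forms

/-- The complex manifolds `M t`, for `t` in the disc of radius `ε`, form an analytic family with
total space `X` and projection `π`: the map `π` is a proper holomorphic submersion of `X` onto the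
disc, and `M t` is the fibre `π⁻¹(t)` with its structure of a complex submanifold of `X`, the
inclusion being the holomorphic embedding `ι t`. -/
structure IsAnalyticFamily
    {E : Type*} [NormedAddCommGroup E] [NormedSpace ℂ E]
    {F : Type*} [NormedAddCommGroup F] [NormedSpace ℂ F]
    {X : Type*} [TopologicalSpace X] [ChartedSpace E X]
    {ε : ℝ} {M : Metric.ball (0 : ℂ) ε → Type*}
    [∀ t, TopologicalSpace (M t)] [∀ t, ChartedSpace F (M t)]
    (π : X → Metric.ball (0 : ℂ) ε) (ι : ∀ t, M t → X) : Prop where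
  isProperMap : IsProperMap π
  holomorphic : ContMDiff 𝓘(ℂ, E) 𝓘(ℂ, ℂ) ω (fun x ↦ (π x : ℂ))
  submersion : ∀ x, Function.Surjective (mfderiv 𝓘(ℂ, E) 𝓘(ℂ, ℂ) (fun x ↦ (π x : ℂ)) x)
  finrank_eq : Module.finrank ℂ E = Module.finrank ℂ F + 1
  fiber_range : ∀ t, Set.range (ι t) = π ⁻¹' {t}
  fiber_isEmbedding : ∀ t, Topology.IsEmbedding (ι t)
  fiber_holomorphic : ∀ t, ContMDiff 𝓘(ℂ, F) 𝓘(ℂ, E) ω (ι t)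
  fiber_immersion : ∀ t x, Function.Injective (mfderiv 𝓘(ℂ, F) 𝓘(ℂ, E) (ι t) x)

end LCSTaming

end

/-!
# Stability of taming LCS forms under small deformations

The equations `dθ = 0` and `dΩ = θ ∧ Ω` are preserved by pullback along arbitrary smooth maps, and
taming is an open condition. It is therefore enough to carry the pair `(Ω, θ)` from the central
fibre `M₀` to the nearby fibres by smooth maps `M_t → M₀` which are close to the identity; these
need not be diffeomorphisms, so that Ehresmann's theorem is not used. They are the restrictions of a
smooth retraction `r` of a neighbourhood of `M₀` in the total space `X`
(`exists_retraction_of_embedding`), and the form on `M_t` is the restriction of `r^* Ω`.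

The retraction is the composition of a smooth map `g` of `X` to a Euclidean space, injective and
immersive along the compact set `M₀` (`exists_contMDiff_euclidean_injOn`), and a nearest point map
onto `g(M₀)`. A nearest point solves the critical point equation of the distance function, and near
`g(M₀)` the inverse function theorem shows that this equation has only one solution close to a given
point, which depends smoothly on parameters (`exists_contDiffAt_of_normalDefect_eq_zero`).
Continuity of nearest point maps at the points of `g(M₀)` then gives their smoothness in a
neighbourhood (`exists_retraction_of_embedding_euclidean`).

For the taming condition, `T M₀` is the kernel of `dπ` along `M₀`, so `r^* Ω` is positive on the
complex lines in `ker dπ` at the points of `M₀`. By compactness of the unit sphere this persists at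
nearby points of `X` (`TamesAlongKer.eventually`), hence, `π` being a closed map, at all points of
the fibres `M_t` with `t` small.
-/

noncomputable section

namespace LCSTaming

/-! ### Pullback of differential forms -/

section PullbackModel

variable {G V W : Type*} [NormedAddCommGroup G] [NormedSpace ℝ G]
  [NormedAddCommGroup V] [NormedSpace ℝ V]
  [NormedAddCommGroup W] [NormedSpace ℝ W]

theorem contDiffAt_toContinuousMultilinearMap_comp_iff [FiniteDimensional ℝ V]
    {ι : Type*} [Fintype ι] {f : G → V [⋀^ι]→L[ℝ] ℝ} {n : WithTop ℕ∞} {x : G} :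
    ContDiffAt ℝ n (fun y ↦ (f y).toContinuousMultilinearMap) x ↔ ContDiffAt ℝ n f x := by
  classical
  set T : (V [⋀^ι]→L[ℝ] ℝ) →L[ℝ] ContinuousMultilinearMap ℝ (fun _ : ι ↦ V) ℝ :=
    ContinuousAlternatingMap.toContinuousMultilinearMapCLM ℝ
  have hT : Function.Injective T := ContinuousAlternatingMap.toContinuousMultilinearMap_injective
  have : FiniteDimensional ℝ (ContinuousMultilinearMap ℝ (fun _ : ι ↦ V) ℝ) :=
    Module.Finite.of_injective
      (ContinuousMultilinearMap.toMultilinearMapLinear (R' := ℝ) (A := ℝ) (M₁ := fun _ : ι ↦ V))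
      ContinuousMultilinearMap.toMultilinearMap_injective
  -- a linear left inverse is automatically continuous on these finite-dimensional spaces
  obtain ⟨S, hS⟩ := T.toLinearMap.exists_leftInverse_of_injective
    (LinearMap.ker_eq_bot.2 hT)
  refine ⟨fun h ↦ ?_, fun h ↦ T.contDiff.contDiffAt.comp x h⟩
  have := (LinearMap.toContinuousLinearMap S).contDiff.contDiffAt.comp x h
  convert this using 1
  ext1 y
  exact (LinearMap.congr_fun hS (f y)).symm

theorem _root_.ContDiffAt.compContinuousLinearMap_alternating [FiniteDimensional ℝ V]
    [FiniteDimensional ℝ W] {ι : Type*} [Fintype ι]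
    {f : G → V [⋀^ι]→L[ℝ] ℝ} {A : G → W →L[ℝ] V} {n : WithTop ℕ∞} {x : G}
    (hf : ContDiffAt ℝ n f x) (hA : ContDiffAt ℝ n A x) :
    ContDiffAt ℝ n (fun y ↦ (f y).compContinuousLinearMap (A y)) x := by
  rw [← contDiffAt_toContinuousMultilinearMap_comp_iff] at hf ⊢
  have hC := ContinuousMultilinearMap.contDiff (𝕜 := ℝ) (E := fun _ : ι ↦ W →L[ℝ] V)
    (F := ContinuousMultilinearMap ℝ (fun _ : ι ↦ V) ℝ →L[ℝ]
      ContinuousMultilinearMap ℝ (fun _ : ι ↦ W) ℝ) (n := n)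
    (ContinuousMultilinearMap.compContinuousLinearMapContinuousMultilinear ℝ
      (fun _ : ι ↦ W) (fun _ : ι ↦ V) ℝ)
  have := (hC.contDiffAt (x := fun _ ↦ A x)).comp x (contDiffAt_pi.2 fun _ : ι ↦ hA)
  exact this.clm_apply hf

theorem wedgeOneTwo_compContinuousLinearMap
    (θ : V [⋀^Fin 1]→L[ℝ] ℝ) (Ω : V [⋀^Fin 2]→L[ℝ] ℝ) (A : W →L[ℝ] V) :
    (wedgeOneTwo θ Ω).compContinuousLinearMap A =
      wedgeOneTwo (θ.compContinuousLinearMap A) (Ω.compContinuousLinearMap A) := by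
  ext v
  have hv : v = ![v 0, v 1, v 2] := by ext i; fin_cases i <;> rfl
  rw [hv, wedgeOneTwo_apply, ContinuousAlternatingMap.compContinuousLinearMap_apply]
  have h3 (a b c : W) : A ∘ ![a, b, c] = ![A a, A b, A c] := by ext i; fin_cases i <;> rfl
  have h2 (a b : W) : A ∘ ![a, b] = ![A a, A b] := by ext i; fin_cases i <;> rfl
  have h1 (a : W) : A ∘ ![a] = ![A a] := by ext i; fin_cases i; rfl
  simp only [ContinuousAlternatingMap.compContinuousLinearMap_apply, h1, h2, h3, wedgeOneTwo_apply]

end PullbackModel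

section Pullback

variable {E : Type*} [NormedAddCommGroup E] [NormedSpace ℂ E]
  {F : Type*} [NormedAddCommGroup F] [NormedSpace ℂ F]
  {M : Type*} [TopologicalSpace M] [ChartedSpace E M]
  {N : Type*} [TopologicalSpace N] [ChartedSpace F N]

/-- The pullback `f^* α` of a real form along a map of the underlying real manifolds
(meaningful where `f` is differentiable). -/
def pullbackForm {k : ℕ} (f : M → N) (α : RealForm F N k) : RealForm E M k :=
  fun x ↦ (α (f x)).compContinuousLinearMap (mfderiv 𝓘(ℝ, E) 𝓘(ℝ, F) f x)

/-- Equality of values of a form at two equal points, with all tangent spaces read as `F`. -/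
theorem RealForm.apply_congr {k : ℕ} (α : RealForm F N k) {x y : N} (h : x = y)
    {v w : Fin k → F} (hvw : v = w) :
    (α x : F [⋀^Fin k]→L[ℝ] ℝ) v = (α y : F [⋀^Fin k]→L[ℝ] ℝ) w := by
  subst h; subst hvw; rfl

variable [IsManifold 𝓘(ℝ, E) ∞ M] [IsManifold 𝓘(ℝ, F) ∞ N]

/-- In the charts `e` and `e'`, the pullback `f^* α` is the pullback along the coordinate
expression of `f`. -/
theorem chartRep_pullbackForm {k : ℕ} {f : M → N} {α : RealForm F N k}
    {e : OpenPartialHomeomorph M E} (he : e ∈ atlas E M)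
    {e' : OpenPartialHomeomorph N F} (he' : e' ∈ atlas F N) {y : E} (hy : y ∈ e.target)
    (hfy : f (e.symm y) ∈ e'.source)
    (hf : MDifferentiableAt 𝓘(ℝ, E) 𝓘(ℝ, F) f (e.symm y)) :
    chartRep e (pullbackForm f α) y =
      (chartRep e' α (e' (f (e.symm y)))).compContinuousLinearMap
        (fderiv ℝ (e' ∘ f ∘ e.symm) y) := by
  have : IsManifold 𝓘(ℝ, E) 1 M := IsManifold.of_le (n := ∞) (by norm_cast)
  have : IsManifold 𝓘(ℝ, F) 1 N := IsManifold.of_le (n := ∞) (by norm_cast)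
  have hes : MDifferentiableAt 𝓘(ℝ, E) 𝓘(ℝ, E) e.symm y :=
    mdifferentiableAt_atlas_symm he hy
  have he'd : MDifferentiableAt 𝓘(ℝ, F) 𝓘(ℝ, F) e' (f (e.symm y)) :=
    mdifferentiableAt_atlas he' hfy
  have hfe : MDifferentiableAt 𝓘(ℝ, E) 𝓘(ℝ, F) (f ∘ e.symm) y := hf.comp y hes
  have hh : MDifferentiableAt 𝓘(ℝ, E) 𝓘(ℝ, F) (e' ∘ f ∘ e.symm) y :=
    MDifferentiableAt.comp (g := e') y he'd hfe
  have he's : MDifferentiableAt 𝓘(ℝ, F) 𝓘(ℝ, F) e'.symm ((e' ∘ f ∘ e.symm) y) :=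
    mdifferentiableAt_atlas_symm he' (e'.map_source hfy)
  -- differentiate the identity `f ∘ e⁻¹ = e'⁻¹ ∘ (e' ∘ f ∘ e⁻¹)`, valid near `y`
  have hev : f ∘ e.symm =ᶠ[𝓝 y] e'.symm ∘ (e' ∘ f ∘ e.symm) := by
    filter_upwards [hfe.continuousAt (e'.open_source.mem_nhds hfy)] with z hz
    exact (e'.left_inv hz).symm
  have key := hev.mfderiv_eq (I := 𝓘(ℝ, E)) (I' := 𝓘(ℝ, F))
  rw [mfderiv_comp y he's hh, mfderiv_comp y hf hes, mfderiv_eq_fderiv] at key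
  ext v
  refine RealForm.apply_congr α (e'.left_inv hfy).symm ?_
  ext i
  exact DFunLike.congr_fun key (v i)

theorem eventually_chartRep_pullbackForm {k : ℕ} {f : M → N} (α : RealForm F N k)
    {e : OpenPartialHomeomorph M E} (he : e ∈ atlas E M)
    {e' : OpenPartialHomeomorph N F} (he' : e' ∈ atlas F N) {y : E} (hy : y ∈ e.target)
    (hfy : f (e.symm y) ∈ e'.source)
    (hf : ContMDiffAt 𝓘(ℝ, E) 𝓘(ℝ, F) ∞ f (e.symm y)) :
    chartRep e (pullbackForm f α) =ᶠ[𝓝 y] fun z ↦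
      (chartRep e' α ((e' ∘ f ∘ e.symm) z)).compContinuousLinearMap
        (fderiv ℝ (e' ∘ f ∘ e.symm) z) := by
  have : IsManifold 𝓘(ℝ, E) 1 M := IsManifold.of_le (n := ∞) (by norm_cast)
  have : IsManifold 𝓘(ℝ, F) 1 N := IsManifold.of_le (n := ∞) (by norm_cast)
  have hc := e.continuousAt_symm hy
  have h1 := hc.eventually
    ((contMDiffAt_iff_contMDiffAt_nhds (by simp)).1 (hf.of_le (m := 1) (by norm_cast)))
  have h2 : ∀ᶠ z in 𝓝 y, f (e.symm z) ∈ e'.source :=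
    (hf.continuousAt.comp hc) (e'.open_source.mem_nhds hfy)
  filter_upwards [h1, h2, e.open_target.mem_nhds hy] with z hz1 hz2 hz3
  exact chartRep_pullbackForm he he' hz3 hz2 (hz1.mdifferentiableAt (by simp))

theorem contDiffAt_chart_comp {f : M → N}
    {e : OpenPartialHomeomorph M E} (he : e ∈ atlas E M)
    {e' : OpenPartialHomeomorph N F} (he' : e' ∈ atlas F N) {y : E} (hy : y ∈ e.target)
    (hfy : f (e.symm y) ∈ e'.source)
    (hf : ContMDiffAt 𝓘(ℝ, E) 𝓘(ℝ, F) ∞ f (e.symm y)) :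
    ContDiffAt ℝ ∞ (e' ∘ f ∘ e.symm) y := by
  rw [← contMDiffAt_iff_contDiffAt]
  have hes : ContMDiffAt 𝓘(ℝ, E) 𝓘(ℝ, E) ∞ e.symm y :=
    (contMDiffOn_symm_of_mem_maximalAtlas
      (IsManifold.subset_maximalAtlas he)).contMDiffAt (e.open_target.mem_nhds hy)
  have he'd : ContMDiffAt 𝓘(ℝ, F) 𝓘(ℝ, F) ∞ e' (f (e.symm y)) :=
    contMDiffAt_of_mem_maximalAtlas (IsManifold.subset_maximalAtlas he') hfy
  exact he'd.comp y (hf.comp y hes)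

theorem contDiffAt_chartRep_pullbackForm [FiniteDimensional ℂ E] [FiniteDimensional ℂ F]
    {k : ℕ} {f : M → N} {α : RealForm F N k} (hα : IsSmoothForm α)
    {e : OpenPartialHomeomorph M E} (he : e ∈ atlas E M) {y : E} (hy : y ∈ e.target)
    (hf : ContMDiffAt 𝓘(ℝ, E) 𝓘(ℝ, F) ∞ f (e.symm y)) :
    ContDiffAt ℝ ∞ (chartRep e (pullbackForm f α)) y := by
  have : FiniteDimensional ℝ E := FiniteDimensional.complexToReal E
  have : FiniteDimensional ℝ F := FiniteDimensional.complexToReal F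
  set e' := chartAt F (f (e.symm y))
  have he' : e' ∈ atlas F N := chart_mem_atlas F _
  have hfy : f (e.symm y) ∈ e'.source := mem_chart_source F _
  refine ContDiffAt.congr_of_eventuallyEq ?_
    (eventually_chartRep_pullbackForm α he he' hy hfy hf)
  have hh := contDiffAt_chart_comp he he' hy hfy hf
  have ha : ContDiffAt ℝ ∞ (chartRep e' α) ((e' ∘ f ∘ e.symm) y) :=
    (hα e' he').contDiffAt (e'.open_target.mem_nhds (e'.map_source hfy))
  exact (ha.comp y hh).compContinuousLinearMap_alternating (hh.fderiv_right (by simp))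

theorem extDeriv_chartRep_pullbackForm {k : ℕ} {f : M → N} {α : RealForm F N k}
    (hα : IsSmoothForm α) {e : OpenPartialHomeomorph M E} (he : e ∈ atlas E M)
    {e' : OpenPartialHomeomorph N F} (he' : e' ∈ atlas F N)
    {y : E} (hy : y ∈ e.target) (hfy : f (e.symm y) ∈ e'.source)
    (hf : ContMDiffAt 𝓘(ℝ, E) 𝓘(ℝ, F) ∞ f (e.symm y)) :
    extDeriv (chartRep e (pullbackForm f α)) y =
      (extDeriv (chartRep e' α) (e' (f (e.symm y)))).compContinuousLinearMap
        (fderiv ℝ (e' ∘ f ∘ e.symm) y) := by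
  rw [(eventually_chartRep_pullbackForm α he he' hy hfy hf).extDeriv_eq]
  have hh := contDiffAt_chart_comp he he' hy hfy hf
  have ha : ContDiffAt ℝ ∞ (chartRep e' α) ((e' ∘ f ∘ e.symm) y) :=
    (hα e' he').contDiffAt (e'.open_target.mem_nhds (e'.map_source hfy))
  exact extDeriv_pullback (ha.differentiableAt (by simp)) hh (by simp; norm_cast)

theorem IsSmoothForm.pullback [FiniteDimensional ℂ E] [FiniteDimensional ℂ F] {k : ℕ}
    {f : M → N} (hf : ContMDiff 𝓘(ℝ, E) 𝓘(ℝ, F) ∞ f)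
    {α : RealForm F N k} (hα : IsSmoothForm α) : IsSmoothForm (pullbackForm (E := E) f α) :=
  fun _ he _ hy ↦
    (contDiffAt_chartRep_pullbackForm hα he hy hf.contMDiffAt).contDiffWithinAt

theorem IsClosedForm.pullback {k : ℕ} {f : M → N} (hf : ContMDiff 𝓘(ℝ, E) 𝓘(ℝ, F) ∞ f)
    {α : RealForm F N k} (hα : IsSmoothForm α) (hc : IsClosedForm α) :
    IsClosedForm (pullbackForm (E := E) f α) := by
  intro e he y hy
  have hs := mem_chart_source F (f (e.symm y))
  rw [extDeriv_chartRep_pullbackForm hα he (chart_mem_atlas F _) hy hs hf.contMDiffAt,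
    hc _ (chart_mem_atlas F _) _ ((chartAt F _).map_source hs)]
  rfl

theorem IsLeeForm.pullback {f : M → N} (hf : ContMDiff 𝓘(ℝ, E) 𝓘(ℝ, F) ∞ f)
    {θ : RealForm F N 1} {Ω : RealForm F N 2} (hΩ : IsSmoothForm Ω)
    (h : IsLeeForm θ Ω) :
    IsLeeForm (pullbackForm (E := E) f θ) (pullbackForm f Ω) := by
  intro e he y hy
  have hs := mem_chart_source F (f (e.symm y))
  have ha := chart_mem_atlas F (f (e.symm y))
  have hd := hf.mdifferentiable (by simp) (e.symm y)
  rw [extDeriv_chartRep_pullbackForm hΩ he ha hy hs hf.contMDiffAt,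
    h _ ha _ ((chartAt F _).map_source hs), wedgeOneTwo_compContinuousLinearMap,
    chartRep_pullbackForm he ha hy hs hd, chartRep_pullbackForm he ha hy hs hd]

/-- Pulling back a taming LCS form yields one as soon as the pulled-back `2`-form still tames:
the differential equations are automatically preserved. -/
theorem admitsTamingLCSForm_of_pullback [FiniteDimensional ℂ E] [FiniteDimensional ℂ F]
    {f : M → N} (hf : ContMDiff 𝓘(ℝ, E) 𝓘(ℝ, F) ∞ f)
    {θ : RealForm F N 1} {Ω : RealForm F N 2} (hΩ : IsSmoothForm Ω) (hθ : IsSmoothForm θ)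
    (hc : IsClosedForm θ) (h : IsLeeForm θ Ω) (ht : Tames (pullbackForm (E := E) f Ω)) :
    AdmitsTamingLCSForm E M :=
  ⟨pullbackForm f Ω, pullbackForm f θ, hΩ.pullback hf, hθ.pullback hf, hc.pullback hf hθ,
    h.pullback hf hΩ, ht⟩

end Pullback

/-! ### Smooth retractions onto compact submanifolds -/

section NearestPoint

variable {F : Type*} [NormedAddCommGroup F] [NormedSpace ℝ F]
  {H : Type*} [NormedAddCommGroup H] [InnerProductSpace ℝ H]

/-- The differential at `y` of `y ↦ -‖z - f y‖² / 2`, as a function of `(z, y)`. -/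
def normalDefect (f : F → H) (p : H × F) : F →L[ℝ] ℝ :=
  (innerSL ℝ (p.1 - f p.2)).comp (fderiv ℝ f p.2)

/-- At a nearest point the normal defect vanishes. -/
theorem normalDefect_eq_zero_of_isMin {f : F → H} {z : H} {y : F} (hf : DifferentiableAt ℝ f y)
    (hmin : ∀ᶠ y' in 𝓝 y, ‖z - f y‖ ≤ ‖z - f y'‖) : normalDefect f (z, y) = 0 := by
  have hd : HasFDerivAt (fun y' ↦ ‖z - f y'‖ ^ 2)
      (2 • (innerSL ℝ (z - f y)).comp (-fderiv ℝ f y)) y :=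
    (hf.hasFDerivAt.const_sub z).norm_sq
  have hm : IsLocalMin (fun y' ↦ ‖z - f y'‖ ^ 2) y := by
    filter_upwards [hmin] with y' hy'
    gcongr
  have h0 := hm.hasFDerivAt_eq_zero hd
  ext v
  have hv := DFunLike.congr_fun h0 v
  simp only [smul_apply, ContinuousLinearMap.comp_apply, neg_apply, map_neg, zero_apply,
    smul_neg, neg_eq_zero, smul_eq_zero, OfNat.ofNat_ne_zero, false_or] at hv
  exact hv

theorem contDiffAt_normalDefect {f : F → H} {p : H × F} (hf : ContDiffAt ℝ ∞ f p.2) :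
    ContDiffAt ℝ ∞ (normalDefect f) p := by
  have h1 : ContDiffAt ℝ ∞ (fun p : H × F ↦ f p.2) p := hf.comp p contDiffAt_snd
  have h2 : ContDiffAt ℝ ∞ (fun p : H × F ↦ fderiv ℝ f p.2) p :=
    ContDiffAt.comp p (hf.fderiv_right (m := ∞) (by simp)) contDiffAt_snd
  exact ((innerSL ℝ).contDiff.contDiffAt.comp p (contDiffAt_fst.sub h1)).clm_comp h2

/-- At `(f b, b)` the second derivative of `f` does not contribute, as it is paired with
`f b - f b = 0`. -/
theorem hasFDerivAt_normalDefect {f : F → H} {b : F} (hf : ContDiffAt ℝ ∞ f b) :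
    ∃ L : H × F →L[ℝ] F →L[ℝ] ℝ, HasFDerivAt (normalDefect f) L (f b, b) ∧
      ∀ z y v, L (z, y) v = inner ℝ (z - fderiv ℝ f b y) (fderiv ℝ f b v) := by
  have hfd : HasFDerivAt f (fderiv ℝ f b) (f b, b).2 :=
    (hf.differentiableAt (by simp)).hasFDerivAt
  have h1 : HasFDerivAt (fun p : H × F ↦ f p.2) _ (f b, b) := hfd.comp (f b, b) hasFDerivAt_snd
  have h2 : HasFDerivAt (fun p : H × F ↦ fderiv ℝ f p.2) _ (f b, b) :=
    HasFDerivAt.comp (g := fderiv ℝ f) (f b, b)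
      (((hf.fderiv_right (m := ∞) (by simp)).differentiableAt (by simp)).hasFDerivAt)
      hasFDerivAt_snd
  have h3 := ((innerSL ℝ).hasFDerivAt.comp (f b, b) (hasFDerivAt_fst.sub h1)).clm_comp h2
  refine ⟨_, h3, fun z y v ↦ ?_⟩
  simp only [Function.comp_apply, Pi.sub_apply, sub_self, map_zero, ContinuousLinearMap.zero_comp,
    zero_add]
  rfl

/-- Near `(f b, b)` the critical point equation for the distance to an immersed submanifold
has at most one solution `y`, which depends smoothly on `z`: this is the inverse function theorem
for `(z, y) ↦ (z, normalDefect f (z, y))`. -/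
theorem exists_contDiffAt_of_normalDefect_eq_zero [FiniteDimensional ℝ F] [FiniteDimensional ℝ H]
    {f : F → H} {b : F} {U : Set F} (hU : U ∈ 𝓝 b) (hf : ∀ y ∈ U, ContDiffAt ℝ ∞ f y)
    (hinj : Function.Injective (fderiv ℝ f b)) :
    ∃ Y : H → F, (∀ᶠ z in 𝓝 (f b), ContDiffAt ℝ ∞ Y z) ∧
      ∀ᶠ p in 𝓝 (f b, b), normalDefect f p = 0 → p.2 = Y p.1 := by
  have hb := hf b (mem_of_mem_nhds hU)
  set Ψ : H × F → H × (F →L[ℝ] ℝ) := fun p ↦ (p.1, normalDefect f p) with hΨ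
  have hΨs : ∀ p : H × F, p.2 ∈ U → ContDiffAt ℝ ∞ Ψ p := fun p hp ↦
    contDiffAt_fst.prodMk (contDiffAt_normalDefect (hf _ hp))
  obtain ⟨L, hL, hLv⟩ := hasFDerivAt_normalDefect hb
  set A : H × F →L[ℝ] H × (F →L[ℝ] ℝ) := (ContinuousLinearMap.fst ℝ H F).prod L
  have hA : HasFDerivAt Ψ A (f b, b) := hasFDerivAt_fst.prodMk hL
  have hAinj : Function.Injective A := by
    rw [injective_iff_map_eq_zero]
    rintro ⟨z, y⟩ h
    obtain ⟨h1, h2⟩ := Prod.mk_inj.1 h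
    obtain rfl : z = 0 := h1
    have h3 := hLv 0 y y
    rw [show L (0, y) = 0 from h2] at h3
    -- testing the linearized equation on `y` itself gives `‖f'(b) y‖² = 0`
    simp only [zero_apply, zero_sub, inner_neg_left] at h3
    have h4 : fderiv ℝ f b y = 0 := inner_self_eq_zero.1 (neg_eq_zero.1 h3.symm)
    rw [hinj (h4.trans (map_zero _).symm), Prod.mk_zero_zero]
  have hrank : Module.finrank ℝ (H × F) = Module.finrank ℝ (H × (F →L[ℝ] ℝ)) := by
    rw [Module.finrank_prod, Module.finrank_prod,
      ← (LinearMap.toContinuousLinearMap (𝕜 := ℝ) (E := F) (F' := ℝ)).finrank_eq]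
    congr 1
    exact (Subspace.dual_finrank_eq (K := ℝ) (V := F)).symm
  set B : (H × F) ≃L[ℝ] H × (F →L[ℝ] ℝ) :=
    (LinearEquiv.ofInjectiveOfFinrankEq A.toLinearMap hAinj hrank).toContinuousLinearEquiv
  have hAB : (B : H × F →L[ℝ] H × (F →L[ℝ] ℝ)) = A := rfl
  have hΨb : ContDiffAt ℝ ∞ Ψ (f b, b) := hΨs _ (mem_of_mem_nhds hU)
  set Φ := hΨb.toOpenPartialHomeomorph Ψ (f' := B) (hAB ▸ hA) (by simp)
  have hbs : (f b, b) ∈ Φ.source := hΨb.mem_toOpenPartialHomeomorph_source _ _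
  have hΨ0 : Ψ (f b, b) = (f b, 0) := by simp [hΨ, normalDefect]
  -- at all points near `(f b, b)` the map `Ψ` is smooth with invertible derivative
  have hev : ∀ᶠ p in 𝓝 (f b, b), ContDiffAt ℝ ∞ Ψ p ∧ ∃ B' : (H × F) ≃L[ℝ] H × (F →L[ℝ] ℝ),
      HasFDerivAt Ψ (B' : H × F →L[ℝ] H × (F →L[ℝ] ℝ)) p := by
    have hc : ContinuousAt (fderiv ℝ Ψ) (f b, b) :=
      (hΨb.fderiv_right (m := 0) (by simp)).continuousAt
    have hr : Set.range ((↑) : ((H × F) ≃L[ℝ] H × (F →L[ℝ] ℝ)) → _) ∈ 𝓝 (fderiv ℝ Ψ (f b, b)) := by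
      rw [hA.fderiv, ← hAB]
      exact ContinuousLinearEquiv.isOpen.mem_nhds ⟨B, rfl⟩
    filter_upwards [hc hr, (continuous_snd.tendsto (f b, b)) hU] with p hp1 hp2
    obtain ⟨B', hB'⟩ := hp1
    refine ⟨hΨs p hp2, B', ?_⟩
    rw [hB']
    exact ((hΨs p hp2).differentiableAt (by simp)).hasFDerivAt
  have hz : Filter.Tendsto (fun z : H ↦ (z, (0 : F →L[ℝ] ℝ))) (𝓝 (f b)) (𝓝 (Φ (f b, b))) := by
    have : Φ (f b, b) = (f b, 0) := hΨ0
    rw [this]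
    exact (Continuous.prodMk_left (0 : F →L[ℝ] ℝ)).continuousAt
  refine ⟨fun z ↦ (Φ.symm (z, 0)).2, ?_, ?_⟩
  · have ht := Φ.map_source hbs
    have hsymm := (Φ.continuousAt_symm ht).tendsto
    rw [Φ.left_inv hbs] at hsymm
    filter_upwards [(hsymm.comp hz).eventually hev, hz (Φ.open_target.mem_nhds ht)] with z hz1 hz2
    obtain ⟨hs, B', hB'⟩ := hz1
    have h1 : ContDiffAt ℝ ∞ Φ.symm (z, 0) := Φ.contDiffAt_symm hz2 hB' hs
    exact contDiffAt_snd.comp z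
      (h1.comp z (contDiffAt_id.prodMk contDiffAt_const))
  · filter_upwards [Φ.open_source.mem_nhds hbs] with p hp h0
    have : Φ p = (p.1, 0) := by rw [← h0]; rfl
    rw [← this, Φ.left_inv hp]

end NearestPoint

section Retraction

variable {F : Type*} [NormedAddCommGroup F] [NormedSpace ℝ F] [FiniteDimensional ℝ F]
  {N : Type*} [TopologicalSpace N] [ChartedSpace F N] [IsManifold 𝓘(ℝ, F) ∞ N]

/-- A nearest point map onto a compact embedded submanifold `f(N)` of a Euclidean space is a
retraction that is smooth near `f(N)`. -/
theorem exists_retraction_of_embedding_euclidean [CompactSpace N] [Nonempty N]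
    {H : Type*} [NormedAddCommGroup H] [InnerProductSpace ℝ H] [FiniteDimensional ℝ H]
    {f : N → H} (hf : ContMDiff 𝓘(ℝ, F) 𝓘(ℝ, H) ∞ f) (hinj : Function.Injective f)
    (himm : ∀ n, Function.Injective (mfderiv 𝓘(ℝ, F) 𝓘(ℝ, H) f n)) :
    ∃ R : H → N, (∀ n, R (f n) = n) ∧
      ∀ n, ∀ᶠ z in 𝓝 (f n), ContMDiffAt 𝓘(ℝ, H) 𝓘(ℝ, F) ∞ R z := by
  have : IsManifold 𝓘(ℝ, F) 1 N := IsManifold.of_le (n := ∞) (by norm_cast)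
  -- `R z` is any point of `N` whose image is nearest to `z`
  have hmin : ∀ z : H, ∃ n, ∀ m, ‖z - f n‖ ≤ ‖z - f m‖ := fun z ↦ by
    obtain ⟨n, -, hn⟩ := isCompact_univ.exists_isMinOn Set.univ_nonempty
      (f := fun m ↦ ‖z - f m‖) (continuous_const.sub hf.continuous).norm.continuousOn
    exact ⟨n, fun m ↦ hn (Set.mem_univ m)⟩
  choose R hR using hmin
  have hRf : ∀ n, R (f n) = n := fun n ↦ by
    have := hR (f n) n
    rw [sub_self, norm_zero, norm_le_zero_iff, sub_eq_zero] at this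
    exact hinj this.symm
  refine ⟨R, hRf, fun n ↦ ?_⟩
  have hemb := (hf.continuous.isClosedEmbedding hinj).isEmbedding
  -- however the nearest points are chosen, `R` is continuous at the points of `f(N)`
  have hRc : Filter.Tendsto R (𝓝 (f n)) (𝓝 n) := by
    rw [hemb.tendsto_nhds_iff, tendsto_iff_norm_sub_tendsto_zero]
    have h0 : Filter.Tendsto (fun z ↦ 2 * ‖z - f n‖) (𝓝 (f n)) (𝓝 0) := by
      have : Continuous fun z ↦ 2 * ‖z - f n‖ := by fun_prop
      simpa using this.tendsto (f n)
    refine squeeze_zero (fun _ ↦ norm_nonneg _) (fun z ↦ ?_) h0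
    calc ‖f (R z) - f n‖ = ‖(z - f n) - (z - f (R z))‖ := by congr 1; abel
      _ ≤ ‖z - f n‖ + ‖z - f (R z)‖ := norm_sub_le _ _
      _ ≤ 2 * ‖z - f n‖ := by linarith [hR z n]
  set ψ := chartAt F n
  have hn : n ∈ ψ.source := mem_chart_source F n
  have hsymm : ∀ y ∈ ψ.target, ContMDiffAt 𝓘(ℝ, F) 𝓘(ℝ, F) ∞ ψ.symm y := fun y hy ↦
    contMDiffOn_chart_symm.contMDiffAt (ψ.open_target.mem_nhds hy)
  set g : F → H := f ∘ ψ.symm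
  have hg : ∀ y ∈ ψ.target, ContDiffAt ℝ ∞ g y := fun y hy ↦
    contMDiffAt_iff_contDiffAt.1 (hf.contMDiffAt.comp y (hsymm y hy))
  have hgn : g (ψ n) = f n := congrArg f (ψ.left_inv hn)
  have hginj : Function.Injective (fderiv ℝ g (ψ n)) := by
    rw [← mfderiv_eq_fderiv, mfderiv_comp (ψ n) (hf.mdifferentiable (by simp) _)
      ((hsymm _ (ψ.map_source hn)).mdifferentiableAt (by simp))]
    exact (himm _).comp
      ((mdifferentiable_chart (I := 𝓘(ℝ, F)) n).symm.mfderiv_injective (ψ.map_source hn))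
  obtain ⟨Y, hY, hYeq⟩ := exists_contDiffAt_of_normalDefect_eq_zero
    (ψ.open_target.mem_nhds (ψ.map_source hn)) hg hginj
  rw [hgn] at hY hYeq
  have hpair : Filter.Tendsto (fun z ↦ (z, ψ (R z))) (𝓝 (f n)) (𝓝 (f n, ψ n)) :=
    Filter.Tendsto.prodMk_nhds Filter.tendsto_id ((ψ.continuousAt hn).tendsto.comp hRc)
  have hloc : ∀ᶠ z in 𝓝 (f n), R z ∈ ψ.source ∧ ψ (R z) = Y z := by
    filter_upwards [hRc (ψ.open_source.mem_nhds hn), hpair.eventually hYeq] with z hz1 hz2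
    refine ⟨hz1, hz2 (normalDefect_eq_zero_of_isMin ?_ (Filter.Eventually.of_forall fun y' ↦ ?_))⟩
    · exact (hg _ (ψ.map_source hz1)).differentiableAt (by simp)
    · have : g (ψ (R z)) = f (R z) := congrArg f (ψ.left_inv hz1)
      rw [this]
      exact hR z _
  filter_upwards [hloc.eventually_nhds, hY] with z hz1 hz2
  obtain ⟨hzs, hzY⟩ := hz1.self_of_nhds
  refine ((hsymm _ (hzY ▸ ψ.map_source hzs)).comp z
    (contMDiffAt_iff_contDiffAt.2 hz2)).congr_of_eventuallyEq (hz1.mono fun w hw ↦ ?_)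
  rw [Function.comp_apply, ← hw.2, ψ.left_inv hw.1]

variable {E : Type*} [NormedAddCommGroup E] [NormedSpace ℝ E] [FiniteDimensional ℝ E]
  {X : Type*} [TopologicalSpace X] [T2Space X] [ChartedSpace E X] [IsManifold 𝓘(ℝ, E) ∞ X]

/-- A version of the weak Whitney embedding theorem: some smooth map of `X` to a Euclidean space
is injective and immersive on a given compact set. -/
theorem exists_contMDiff_euclidean_injOn {s : Set X} (hs : IsCompact s) :
    ∃ (n : ℕ) (g : X → EuclideanSpace ℝ (Fin n)), ContMDiff 𝓘(ℝ, E) (𝓡 n) ∞ g ∧ s.InjOn g ∧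
      ∀ x ∈ s, Function.Injective (mfderiv 𝓘(ℝ, E) (𝓡 n) g x) := by
  have : IsManifold 𝓘(ℝ, E) 1 X := IsManifold.of_le (n := ∞) (by norm_cast)
  let χ : ∀ x : X, SmoothBumpFunction 𝓘(ℝ, E) x := fun _ ↦ Classical.arbitrary _
  have hsrc : ∀ i x, χ i x = 1 → x ∈ (chartAt E i).source := fun i x h ↦
    (χ i).support_subset_source (by simp [h])
  obtain ⟨T, -, hT⟩ := hs.elim_nhds_subcover (fun x ↦ interior {y : X | χ x =ᶠ[𝓝 y] 1})
    (fun x _ ↦ by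
      rw [interior_mem_nhds]
      exact (χ x).eventuallyEq_one.eventuallyEq_nhds)
  have hT' : ∀ x ∈ s, ∃ i : T, χ i =ᶠ[𝓝 x] 1 := fun x hx ↦ by
    obtain ⟨i, hi, hxi⟩ := Set.mem_iUnion₂.1 (hT hx)
    exact ⟨⟨i, hi⟩, (interior_subset hxi : x ∈ {y : X | χ i =ᶠ[𝓝 y] 1})⟩
  -- the pairs (cut-off chart, cut-off function) for finitely many charts
  let G : X → T → E × ℝ := fun x i ↦ (χ i x • extChartAt 𝓘(ℝ, E) (i : X) x, χ i x)
  have hG : ContMDiff 𝓘(ℝ, E) 𝓘(ℝ, T → E × ℝ) ∞ G := contMDiff_pi_space.2 fun i ↦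
    ((χ i).contMDiff_smul contMDiffOn_extChartAt).prodMk_space (χ i).contMDiff
  have hGinj : s.InjOn G := by
    intro x hx y _ h
    obtain ⟨i, hi⟩ := hT' x hx
    obtain ⟨h1, h2⟩ := Prod.mk_inj.1 (congrFun h i)
    have hx1 : χ i x = 1 := hi.self_of_nhds
    have hy1 : χ i y = 1 := by rw [← hx1]; exact h2.symm
    rw [hx1, hy1, one_smul, one_smul] at h1
    exact (chartAt E (i : X)).injOn (hsrc _ _ hx1) (hsrc _ _ hy1) h1
  have hGimm : ∀ x ∈ s, Function.Injective (mfderiv 𝓘(ℝ, E) 𝓘(ℝ, T → E × ℝ) G x) := by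
    intro x hx
    obtain ⟨i, hi⟩ := hT' x hx
    let L : (T → E × ℝ) →L[ℝ] E :=
      (ContinuousLinearMap.fst ℝ E ℝ).comp (ContinuousLinearMap.proj i)
    have hxs : x ∈ (chartAt E (i : X)).source := hsrc _ _ hi.self_of_nhds
    have h1 : HasMFDerivAt 𝓘(ℝ, E) 𝓘(ℝ, E) (L ∘ G) x
        (L.comp (mfderiv 𝓘(ℝ, E) 𝓘(ℝ, T → E × ℝ) G x)) :=
      L.hasMFDerivAt.comp x (hG.mdifferentiableAt (by simp)).hasMFDerivAt
    have h2 : L ∘ G =ᶠ[𝓝 x] chartAt E (i : X) := hi.mono fun y hy ↦ by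
      simp [L, G, hy]
    have h3 := (h1.congr_of_eventuallyEq h2.symm).mfderiv
    have h4 := (mdifferentiable_chart (I := 𝓘(ℝ, E)) (i : X)).mfderiv_injective hxs
    rw [h3] at h4
    exact Function.Injective.of_comp (f := L) h4
  let e : (T → E × ℝ) ≃L[ℝ] EuclideanSpace ℝ (Fin (Module.finrank ℝ (T → E × ℝ))) :=
    ContinuousLinearEquiv.ofFinrankEq finrank_euclideanSpace_fin.symm
  refine ⟨_, e ∘ G, e.contDiff.contMDiff.comp hG, e.injective.comp_injOn hGinj, fun x hx ↦ ?_⟩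
  rw [mfderiv_comp x e.differentiableAt.mdifferentiableAt (hG.mdifferentiableAt (by simp)),
    e.mfderiv_eq]
  exact e.injective.comp (hGimm x hx)

/-- A compact manifold embedded in `X` is a smooth retract of a neighbourhood. -/
theorem exists_retraction_of_embedding [CompactSpace N] [Nonempty N] {j : N → X}
    (hj : ContMDiff 𝓘(ℝ, F) 𝓘(ℝ, E) ∞ j) (hinj : Function.Injective j)
    (himm : ∀ n, Function.Injective (mfderiv 𝓘(ℝ, F) 𝓘(ℝ, E) j n)) :
    ∃ r : X → N, (∀ n, r (j n) = n) ∧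
      ∀ n, ∀ᶠ x in 𝓝 (j n), ContMDiffAt 𝓘(ℝ, E) 𝓘(ℝ, F) ∞ r x := by
  obtain ⟨d, g, hg, hgi, hgm⟩ :=
    exists_contMDiff_euclidean_injOn (E := E) (isCompact_range hj.continuous)
  obtain ⟨R, hR, hRs⟩ := exists_retraction_of_embedding_euclidean (hg.comp hj)
    (fun a b h ↦ hinj (hgi ⟨a, rfl⟩ ⟨b, rfl⟩ h)) (fun n ↦ by
      rw [mfderiv_comp n (hg.mdifferentiableAt (by simp)) (hj.mdifferentiableAt (by simp))]
      exact (hgm _ ⟨n, rfl⟩).comp (himm n))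
  refine ⟨R ∘ g, hR, fun n ↦ ?_⟩
  filter_upwards [hg.continuous.continuousAt.eventually (hRs n)] with x hx
  exact hx.comp x hg.contMDiffAt

end Retraction

/-! ### The real manifold underlying a complex manifold -/

section Underlying

variable {E : Type*} [NormedAddCommGroup E] [NormedSpace ℂ E]
  {F : Type*} [NormedAddCommGroup F] [NormedSpace ℂ F]
  {M : Type*} [TopologicalSpace M] [ChartedSpace E M]
  {N : Type*} [TopologicalSpace N] [ChartedSpace F N]

variable (E M) in
theorem isManifold_real_of_complex [IsManifold 𝓘(ℂ, E) ω M] : IsManifold 𝓘(ℝ, E) ∞ M := by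
  refine isManifold_of_contDiffOn 𝓘(ℝ, E) ∞ M fun e e' he he' ↦ ?_
  have h := HasGroupoid.compatible (G := contDiffGroupoid ω 𝓘(ℂ, E)) he he'
  rw [contDiffGroupoid, mem_groupoid_of_pregroupoid] at h
  exact (ContDiffOn.restrict_scalars ℝ h.1).of_le (by simp)

theorem _root_.HasMFDerivAt.restrictScalars_real {f : M → N} {x : M} {f' : E →L[ℂ] F}
    (h : HasMFDerivAt 𝓘(ℂ, E) 𝓘(ℂ, F) f x f') :
    HasMFDerivAt 𝓘(ℝ, E) 𝓘(ℝ, F) f x (f'.restrictScalars ℝ) :=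
  ⟨h.1, HasFDerivWithinAt.restrictScalars ℝ h.2⟩

theorem _root_.ContMDiff.real_of_complex {f : M → N} (h : ContMDiff 𝓘(ℂ, E) 𝓘(ℂ, F) ω f) :
    ContMDiff 𝓘(ℝ, E) 𝓘(ℝ, F) ∞ f := fun x ↦ by
  have hx := contMDiffAt_iff.1 (h x)
  exact contMDiffAt_iff.2 ⟨hx.1, (ContDiffWithinAt.restrict_scalars ℝ hx.2).of_le (by simp)⟩

theorem mfderiv_real_eq {f : M → N} {x : M} (h : MDifferentiableAt 𝓘(ℂ, E) 𝓘(ℂ, F) f x)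
    (v : E) : (mfderiv 𝓘(ℝ, E) 𝓘(ℝ, F) f x : E → F) v = mfderiv 𝓘(ℂ, E) 𝓘(ℂ, F) f x v := by
  rw [h.hasMFDerivAt.restrictScalars_real.mfderiv]
  rfl

/-- Holomorphic maps commute with the complex structures. -/
theorem mfderiv_complexStructure {f : M → N} {x : M}
    (h : MDifferentiableAt 𝓘(ℂ, E) 𝓘(ℂ, F) f x) (v : TangentSpace 𝓘(ℝ, E) x) :
    mfderiv 𝓘(ℝ, E) 𝓘(ℝ, F) f x (complexStructure E x v) =
      complexStructure F (f x) (mfderiv 𝓘(ℝ, E) 𝓘(ℝ, F) f x v) := by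
  rw [h.hasMFDerivAt.restrictScalars_real.mfderiv]
  exact (mfderiv 𝓘(ℂ, E) 𝓘(ℂ, F) f x).map_smul Complex.I v

end Underlying

/-! ### Taming along the fibres of a map is an open condition -/

section Vertical

/-- Compactness of the unit sphere makes positivity of `u ↦ β(u, iu)` on the nonzero vectors of
`ker A` stable under small perturbations of `β` and `A`. -/
theorem eventually_pos_of_pos_on_ker {E : Type*} [NormedAddCommGroup E] [NormedSpace ℂ E]
    [FiniteDimensional ℂ E] {Y G : Type*} [TopologicalSpace Y] [NormedAddCommGroup G]
    [NormedSpace ℝ G] {β : Y → E [⋀^Fin 2]→L[ℝ] ℝ} {A : Y → E →L[ℝ] G} {y₀ : Y}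
    (hβ : ContinuousAt β y₀) (hA : ContinuousAt A y₀)
    (h : ∀ u : E, u ≠ 0 → A y₀ u = 0 → 0 < β y₀ ![u, Complex.I • u]) :
    ∀ᶠ y in 𝓝 y₀, ∀ u : E, u ≠ 0 → A y u = 0 → 0 < β y ![u, Complex.I • u] := by
  have : FiniteDimensional ℝ E := FiniteDimensional.complexToReal E
  have : ProperSpace E := FiniteDimensional.proper ℝ E
  have hsphere : ∀ᶠ y in 𝓝 y₀, ∀ u ∈ Metric.sphere (0 : E) 1,
      A y u = 0 → 0 < β y ![u, Complex.I • u] := by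
    refine (isCompact_sphere (0 : E) 1).eventually_forall_of_forall_eventually fun u hu ↦ ?_
    have hu0 : u ≠ 0 := fun h0 ↦ by simp [h0] at hu
    have hAc : ContinuousAt (fun z : Y × E ↦ A z.1 z.2) (y₀, u) :=
      (hA.comp (x := (y₀, u)) continuousAt_fst).clm_apply continuousAt_snd
    have hβc : ContinuousAt (fun z : Y × E ↦ β z.1 ![z.2, Complex.I • z.2]) (y₀, u) := by
      have h1 : ContinuousAt (fun z : Y × E ↦ (β z.1, ![z.2, Complex.I • z.2])) (y₀, u) := by
        refine (hβ.comp (x := (y₀, u)) continuousAt_fst).prodMk (Continuous.continuousAt ?_)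
        fun_prop
      exact (continuous_eval (F := E [⋀^Fin 2]→L[ℝ] ℝ)).continuousAt.comp h1
    by_cases hAu : A y₀ u = 0
    · filter_upwards [hβc.eventually (lt_mem_nhds (h u hu0 hAu))] with z hz _ using hz
    · filter_upwards [hAc.eventually_ne hAu] with z hz hz0 using absurd hz0 hz
  filter_upwards [hsphere] with y hy u hu hAu
  have hn : 0 < ‖u‖ := norm_pos_iff.2 hu
  have hw := hy (‖u‖⁻¹ • u) (by simp [norm_smul, hn.ne']) (by rw [map_smul, hAu, smul_zero])
  have hscale : ![‖u‖⁻¹ • u, Complex.I • (‖u‖⁻¹ • u)] =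
      fun i ↦ (‖u‖⁻¹ : ℝ) • (![u, Complex.I • u] i) := by
    ext i
    fin_cases i
    · rfl
    · exact smul_comm _ _ _
  rw [hscale, ContinuousAlternatingMap.map_smul_univ] at hw
  exact (pos_iff_pos_of_mul_pos hw).1 (by simp only [Finset.prod_const]; positivity)

variable {E : Type*} [NormedAddCommGroup E] [NormedSpace ℂ E]
  {X : Type*} [TopologicalSpace X] [ChartedSpace E X]

/-- The `2`-form `Ω` is positive on the complex lines of the tangent space at `x` that are spanned
by vectors killed by the differential of `p`. -/
def TamesAlongKer {G : Type*} [NormedAddCommGroup G] [NormedSpace ℝ G]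
    (p : X → G) (Ω : RealForm E X 2) (x : X) : Prop :=
  ∀ w : TangentSpace 𝓘(ℝ, E) x, w ≠ 0 → mfderiv 𝓘(ℝ, E) 𝓘(ℝ, G) p x w = 0 →
    0 < Ω x ![w, complexStructure E x w]

variable [IsManifold 𝓘(ℂ, E) ω X]

/-- `TamesAlongKer` read in a chart; the charts being holomorphic, they carry the complex structure
to multiplication by `i`. -/
theorem tamesAlongKer_symm_iff {G : Type*} [NormedAddCommGroup G] [NormedSpace ℝ G]
    {p : X → G} (hp : ContMDiff 𝓘(ℝ, E) 𝓘(ℝ, G) ∞ p) (Ω : RealForm E X 2)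
    {e : OpenPartialHomeomorph X E} (he : e ∈ atlas E X) {y : E} (hy : y ∈ e.target) :
    TamesAlongKer p Ω (e.symm y) ↔ ∀ u : E, u ≠ 0 → fderiv ℝ (p ∘ e.symm) y u = 0 →
      0 < chartRep e Ω y ![u, Complex.I • u] := by
  have := isManifold_real_of_complex E X
  have : IsManifold 𝓘(ℝ, E) 1 X := IsManifold.of_le (n := ∞) (by norm_cast)
  have : IsManifold 𝓘(ℂ, E) 1 X := IsManifold.of_le (n := ω) (by simp)
  have hc : MDifferentiableAt 𝓘(ℂ, E) 𝓘(ℂ, E) e.symm y := mdifferentiableAt_atlas_symm he hy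
  have hr : MDifferentiableAt 𝓘(ℝ, E) 𝓘(ℝ, E) e.symm y := mdifferentiableAt_atlas_symm he hy
  have hbij := (mdifferentiable_of_mem_atlas (I := 𝓘(ℝ, E)) he).symm.mfderiv_bijective hy
  set D := mfderiv 𝓘(ℝ, E) 𝓘(ℝ, E) e.symm y
  have hker : ∀ u : E, fderiv ℝ (p ∘ e.symm) y u =
      mfderiv 𝓘(ℝ, E) 𝓘(ℝ, G) p (e.symm y) (D u) := fun u ↦ by
    rw [← mfderiv_eq_fderiv, mfderiv_comp y (hp.mdifferentiableAt (by simp)) hr]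
    rfl
  have hval : ∀ u : E, chartRep e Ω y ![u, Complex.I • u] =
      Ω (e.symm y) ![D u, complexStructure E (e.symm y) (D u)] := fun u ↦ by
    refine RealForm.apply_congr Ω rfl ?_
    ext i
    fin_cases i
    · rfl
    · exact mfderiv_complexStructure hc u
  have hzero : ∀ u : E, D u = 0 ↔ u = 0 := fun u ↦ map_eq_zero_iff D hbij.1
  constructor
  · intro h u hu hu0
    rw [hval]
    exact h _ (fun h0 ↦ hu ((hzero u).1 h0)) (by rw [← hker]; exact hu0)
  · intro h w hw hw0
    obtain ⟨u, rfl⟩ := hbij.2 w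
    exact (h u (fun h0 ↦ hw ((hzero u).2 h0)) ((hker u).trans hw0)).trans_eq (hval u)

/-- Positivity along the kernel of the differential of `p` spreads to a neighbourhood. -/
theorem TamesAlongKer.eventually [FiniteDimensional ℂ E] {G : Type*} [NormedAddCommGroup G]
    [NormedSpace ℝ G] {p : X → G} (hp : ContMDiff 𝓘(ℝ, E) 𝓘(ℝ, G) ∞ p) {Ω : RealForm E X 2}
    {x : X} (hΩ : ContinuousAt (chartRep (chartAt E x) Ω) (chartAt E x x))
    (h : TamesAlongKer p Ω x) : ∀ᶠ x' in 𝓝 x, TamesAlongKer p Ω x' := by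
  have := isManifold_real_of_complex E X
  set φ := chartAt E x
  have hφ : φ ∈ atlas E X := chart_mem_atlas E x
  have hx : x ∈ φ.source := mem_chart_source E x
  have hA : ContinuousAt (fderiv ℝ (p ∘ φ.symm)) (φ x) := by
    have h1 : ContMDiffAt 𝓘(ℝ, E) 𝓘(ℝ, E) ∞ φ.symm (φ x) :=
      contMDiffOn_chart_symm.contMDiffAt (φ.open_target.mem_nhds (φ.map_source hx))
    have h2 : ContDiffAt ℝ ∞ (p ∘ φ.symm) (φ x) :=
      contMDiffAt_iff_contDiffAt.1 (hp.contMDiffAt.comp _ h1)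
    exact (h2.fderiv_right (m := 0) (by simp)).continuousAt
  have h0 : TamesAlongKer p Ω (φ.symm (φ x)) := by rwa [φ.left_inv hx]
  have hev := eventually_pos_of_pos_on_ker hΩ hA
    ((tamesAlongKer_symm_iff hp Ω hφ (φ.map_source hx)).1 h0)
  filter_upwards [(φ.continuousAt hx).eventually hev, φ.open_source.mem_nhds hx] with x' h1 h2
  rw [← φ.left_inv h2]
  exact (tamesAlongKer_symm_iff hp Ω hφ (φ.map_source h2)).2 h1

end Vertical

/-! ### Taming forms on the fibres of an analytic family -/

section Family

variable {E : Type*} [NormedAddCommGroup E] [NormedSpace ℂ E]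
  {F : Type*} [NormedAddCommGroup F] [NormedSpace ℂ F]
  {X : Type*} [TopologicalSpace X] [ChartedSpace E X]
  {N : Type*} [TopologicalSpace N] [ChartedSpace F N]

theorem pullbackForm_comp_apply {F' : Type*} [NormedAddCommGroup F'] [NormedSpace ℂ F']
    {N' : Type*} [TopologicalSpace N'] [ChartedSpace F' N'] {k : ℕ} {r : X → N'} {j : N → X} {n : N}
    (α : RealForm F' N' k) (hr : MDifferentiableAt 𝓘(ℝ, E) 𝓘(ℝ, F') r (j n))
    (hj : MDifferentiableAt 𝓘(ℝ, F) 𝓘(ℝ, E) j n) :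
    pullbackForm (E := F) (r ∘ j) α n = pullbackForm j (pullbackForm (E := E) r α) n := by
  ext v
  refine RealForm.apply_congr α rfl ?_
  ext i
  rw [mfderiv_comp n hr hj]
  rfl

/-- If `Ω` is positive along the fibres of `p` and `j` is a holomorphic immersion into a fibre,
then `j^* Ω` tames. -/
theorem tames_pullbackForm {G : Type*} [NormedAddCommGroup G] [NormedSpace ℝ G] {p : X → G}
    (hp : ContMDiff 𝓘(ℝ, E) 𝓘(ℝ, G) ∞ p) {Ω : RealForm E X 2} {j : N → X}
    (hj : ContMDiff 𝓘(ℂ, F) 𝓘(ℂ, E) ω j)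
    (himm : ∀ n, Function.Injective (mfderiv 𝓘(ℂ, F) 𝓘(ℂ, E) j n)) {c : G}
    (hc : ∀ n, p (j n) = c) (h : ∀ n, TamesAlongKer p Ω (j n)) :
    Tames (pullbackForm (E := F) j Ω) := by
  intro n v hv
  have hjn : MDifferentiableAt 𝓘(ℂ, F) 𝓘(ℂ, E) j n := hj.mdifferentiableAt (by simp)
  have hjr : MDifferentiableAt 𝓘(ℝ, F) 𝓘(ℝ, E) j n :=
    hj.real_of_complex.mdifferentiableAt (by simp)
  have h1 : mfderiv 𝓘(ℝ, F) 𝓘(ℝ, E) j n v ≠ 0 := fun h0 ↦ hv <| himm n <|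
    ((mfderiv_real_eq hjn v).symm.trans h0).trans (map_zero _).symm
  have h2 : mfderiv 𝓘(ℝ, E) 𝓘(ℝ, G) p (j n) (mfderiv 𝓘(ℝ, F) 𝓘(ℝ, E) j n v) = 0 := by
    have hcomp := mfderiv_comp n (hp.mdifferentiableAt (x := j n) (by simp)) hjr
    have hconst : p ∘ j = fun _ ↦ c := funext hc
    rw [hconst, mfderiv_const] at hcomp
    exact (DFunLike.congr_fun hcomp v).symm
  convert h n _ h1 h2 using 1
  refine RealForm.apply_congr Ω rfl ?_
  ext i
  fin_cases i
  · rfl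
  · exact mfderiv_complexStructure hjn v

/-- Converse to `tames_pullbackForm` at a point: for dimension reasons the kernel of the
differential of `p` is the tangent space of the immersed fibre, so that positivity on the latter
is enough. -/
theorem tamesAlongKer_of_tames_pullbackForm [FiniteDimensional ℂ E] [FiniteDimensional ℂ F]
    (hrank : Module.finrank ℂ E = Module.finrank ℂ F + 1) {p : X → ℂ}
    (hp : ContMDiff 𝓘(ℂ, E) 𝓘(ℂ, ℂ) ω p)
    {Ω : RealForm E X 2} {j : N → X} (hj : ContMDiff 𝓘(ℂ, F) 𝓘(ℂ, E) ω j) {n : N}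
    (hsub : Function.Surjective (mfderiv 𝓘(ℂ, E) 𝓘(ℂ, ℂ) p (j n)))
    (himm : Function.Injective (mfderiv 𝓘(ℂ, F) 𝓘(ℂ, E) j n)) {c : ℂ} (hc : ∀ n, p (j n) = c)
    (h : ∀ v : TangentSpace 𝓘(ℝ, F) n, v ≠ 0 →
      0 < pullbackForm j Ω n ![v, complexStructure F n v]) :
    TamesAlongKer p Ω (j n) := by
  have hjn : MDifferentiableAt 𝓘(ℂ, F) 𝓘(ℂ, E) j n := hj.mdifferentiableAt (by simp)
  have hpn : MDifferentiableAt 𝓘(ℂ, E) 𝓘(ℂ, ℂ) p (j n) := hp.mdifferentiableAt (by simp)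
  intro w hw hw0
  let A : E →L[ℂ] ℂ := mfderiv 𝓘(ℂ, E) 𝓘(ℂ, ℂ) p (j n)
  let T : F →L[ℂ] E := mfderiv 𝓘(ℂ, F) 𝓘(ℂ, E) j n
  have hAT : A.comp T = 0 := by
    have hcomp := mfderiv_comp n hpn hjn
    have hconst : p ∘ j = fun _ ↦ c := funext hc
    rw [hconst, mfderiv_const] at hcomp
    exact hcomp.symm
  have hle : T.toLinearMap.range ≤ A.toLinearMap.ker := by
    rintro _ ⟨v, rfl⟩
    exact DFunLike.congr_fun hAT v
  have hTrank := LinearMap.finrank_range_of_inj (f := T.toLinearMap) himm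
  have hArank := A.toLinearMap.finrank_range_add_finrank_ker
  rw [LinearMap.range_eq_top.2 (show Function.Surjective A.toLinearMap from hsub), finrank_top,
    Module.finrank_self] at hArank
  have heq := Submodule.eq_of_le_of_finrank_eq hle (by omega)
  have hwker : w ∈ A.toLinearMap.ker := by
    have := mfderiv_real_eq hpn w
    exact this.symm.trans hw0
  rw [← heq] at hwker
  obtain ⟨v, hv⟩ := hwker
  have hvw : mfderiv 𝓘(ℝ, F) 𝓘(ℝ, E) j n v = w := (mfderiv_real_eq hjn v).trans hv
  have hv0 : v ≠ 0 := fun h0 ↦ hw <| by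
    rw [← hvw, h0]
    exact map_zero _
  convert h v hv0 using 1
  refine RealForm.apply_congr Ω rfl ?_
  ext i
  fin_cases i
  · exact hvw.symm
  · exact (congrArg (complexStructure E (j n)) hvw.symm).trans (mfderiv_complexStructure hjn v).symm

theorem pullbackForm_id {k : ℕ} (α : RealForm F N k) (n : N) :
    pullbackForm (E := F) id α n = α n := by
  ext v
  refine RealForm.apply_congr α rfl ?_
  ext i
  rw [mfderiv_id]
  rfl

end Family

end LCSTaming

end

theorem proposition4p6
    {E : Type*} [NormedAddCommGroup E] [NormedSpace ℂ E] [FiniteDimensional ℂ E]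
    {F : Type*} [NormedAddCommGroup F] [NormedSpace ℂ F] [FiniteDimensional ℂ F]
    {X : Type*} [TopologicalSpace X] [T2Space X] [SecondCountableTopology X]
    [ChartedSpace E X] [IsManifold 𝓘(ℂ, E) ω X]
    {ε : ℝ} (hε : 0 < ε) {M : Metric.ball (0 : ℂ) ε → Type*}
    [∀ t, TopologicalSpace (M t)] [∀ t, CompactSpace (M t)]
    [∀ t, ChartedSpace F (M t)] [∀ t, IsManifold 𝓘(ℂ, F) ω (M t)]
    (π : X → Metric.ball (0 : ℂ) ε) (ι : ∀ t, M t → X)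
    (hfamily : LCSTaming.IsAnalyticFamily (E := E) (F := F) π ι)
    (h₀ : LCSTaming.AdmitsTamingLCSForm F (M ⟨0, Metric.mem_ball_self hε⟩)) :
    ∃ δ : ℝ, 0 < δ ∧ ∀ t : Metric.ball (0 : ℂ) ε, ‖(t : ℂ)‖ < δ →
      LCSTaming.AdmitsTamingLCSForm F (M t) := by
  open LCSTaming in
  set o : Metric.ball (0 : ℂ) ε := ⟨0, Metric.mem_ball_self hε⟩
  suffices h : ∀ᶠ t in 𝓝 o, AdmitsTamingLCSForm F (M t) by
    obtain ⟨δ, hδ, hball⟩ := Metric.eventually_nhds_iff.1 h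
    refine ⟨δ, hδ, fun t ht ↦ hball ?_⟩
    rwa [Subtype.dist_eq, dist_zero_right]
  have hfib : ∀ t m, π (ι t m) = t := fun t m ↦
    Set.mem_singleton_iff.1 (hfamily.fiber_range t ▸ Set.mem_range_self m : ι t m ∈ π ⁻¹' {t})
  have hclosed := hfamily.isProperMap.isClosedMap
  have hMreal := fun t ↦ isManifold_real_of_complex F (M t)
  have hXreal := isManifold_real_of_complex E X
  have : FiniteDimensional ℝ E := FiniteDimensional.complexToReal E
  have : FiniteDimensional ℝ F := FiniteDimensional.complexToReal F
  obtain ⟨Ω, θ, hΩ, hθ, hθc, hL, hT⟩ := h₀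
  rcases isEmpty_or_nonempty (M o) with hempty | hne
  · -- the central fibre is empty, hence so are the nearby ones, as `π` is closed
    have hev : ∀ᶠ t in 𝓝 o, ∀ x ∈ π ⁻¹' {t}, False := by
      refine hclosed.eventually_nhds_fiber o fun x hx ↦ ?_
      rw [← hfamily.fiber_range o] at hx
      exact hempty.elim hx.choose
    filter_upwards [hev] with t ht
    have : IsEmpty (M t) := ⟨fun m ↦ ht (ι t m) (hfib t m)⟩
    exact admitsTamingLCSForm_of_pullback (f := (isEmptyElim : M t → M o)) isEmptyElim
      hΩ hθ hθc hL isEmptyElim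
  -- the restrictions `M t → M o` of a smooth retraction `r` of a neighbourhood of the central fibre
  -- carry `Ω` and `θ` to the nearby fibres
  set p : X → ℂ := fun x ↦ (π x : ℂ)
  have hp : ContMDiff 𝓘(ℝ, E) 𝓘(ℝ, ℂ) ∞ p := hfamily.holomorphic.real_of_complex
  have hι (t) : ContMDiff 𝓘(ℝ, F) 𝓘(ℝ, E) ∞ (ι t) :=
    (hfamily.fiber_holomorphic t).real_of_complex
  have himm : ∀ n, Function.Injective (mfderiv 𝓘(ℝ, F) 𝓘(ℝ, E) (ι o) n) := fun n v w hvw ↦ by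
    have hd := (hfamily.fiber_holomorphic o).mdifferentiableAt (x := n) (by simp)
    exact hfamily.fiber_immersion o n
      ((mfderiv_real_eq hd v).symm.trans (hvw.trans (mfderiv_real_eq hd w)))
  obtain ⟨r, hr, hrs⟩ :=
    exists_retraction_of_embedding (hι o) (hfamily.fiber_isEmbedding o).injective himm
  -- an open condition that holds on the central fibre holds on the nearby fibres, `π` being closed
  have hev : ∀ᶠ t in 𝓝 o, ∀ x ∈ π ⁻¹' {t}, ContMDiffAt 𝓘(ℝ, E) 𝓘(ℝ, F) ∞ r x ∧
      TamesAlongKer p (pullbackForm (E := E) r Ω) x := by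
    refine hclosed.eventually_nhds_fiber o fun x hx ↦ ?_
    rw [← hfamily.fiber_range o] at hx
    obtain ⟨n, rfl⟩ := hx
    have hrn := (hrs n).self_of_nhds
    refine (hrs n).and (TamesAlongKer.eventually hp ?_ ?_)
    · refine (contDiffAt_chartRep_pullbackForm hΩ (chart_mem_atlas E _)
        (mem_chart_target E _) ?_).continuousAt
      rwa [(chartAt E _).left_inv (mem_chart_source E _)]
    · refine tamesAlongKer_of_tames_pullbackForm hfamily.finrank_eq hfamily.holomorphic
        (hfamily.fiber_holomorphic o) (hfamily.submersion _) (hfamily.fiber_immersion o n)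
        (c := (o : ℂ)) (fun m ↦ congrArg Subtype.val (hfib o m)) fun v hv ↦ ?_
      rw [← pullbackForm_comp_apply Ω (hrn.mdifferentiableAt (by simp))
        ((hι o).mdifferentiableAt (by simp)), show r ∘ ι o = id from funext hr, pullbackForm_id]
      exact hT n v hv
  filter_upwards [hev] with t ht
  have hrt : ∀ m, ContMDiffAt 𝓘(ℝ, E) 𝓘(ℝ, F) ∞ r (ι t m) := fun m ↦ (ht _ (hfib t m)).1
  refine admitsTamingLCSForm_of_pullback (f := r ∘ ι t)
    (fun m ↦ (hrt m).comp m (hι t).contMDiffAt) hΩ hθ hθc hL ?_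
  have htame : Tames (pullbackForm (E := F) (ι t) (pullbackForm (E := E) r Ω)) :=
    tames_pullbackForm hp (hfamily.fiber_holomorphic t) (hfamily.fiber_immersion t)
      (c := (t : ℂ)) (fun m ↦ congrArg Subtype.val (hfib t m)) fun m ↦ (ht _ (hfib t m)).2
  intro m v hv
  rw [pullbackForm_comp_apply Ω ((hrt m).mdifferentiableAt (by simp))
    ((hι t).mdifferentiableAt (by simp))]
  exact htame m v hv
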